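/- Let $\beta\in(0,1)$, $\gamma<0$, and let $Z_1,Z_2,\dots$ be i.i.d. integer-valued random variables with distribution $(q_k)_{k\in\mathbb Z}$, $\mathbb E Z_1^+<\infty$ and $\mathbb P(Z_1<0)>0$. Put $A(x)=\{0,\dots,x\}$ for $x\ge 0$, $A(x)=\{0\}$ for $x<0$, and $D=\{(x,a): x\in\mathbb Z,\ a\in A(x)\}$. A policy $\pi=(\pi_k)_{k\ge0}$ is a sequence of maps that assign to each history $\omega_k=(x_0,a_0,\dots,x_{k-1},a_{k-1},x_k)\in D^k\times\mathbb Z$ an action $a_k=\pi_k(\omega_k)\in A(x_k)$; it is Markov if $\pi_k(\omega_k)=g_k(x_k)$ for functions $g_k:\mathbb Z\to\mathbb N_0$ with $g_k(x)\in A(x)$. The surplus evolves by $x_{k+1}=x_k-a_k+Z_{k+1}$ if $x_k\ge0$ and $x_{k+1}=x_k$ if $x_k<0$; $\mathbb E_x^\pi$ denotes expectation under the policy $\pi$ with $x_0=x$. A policy is optimal if, for every $x\in\mathbb Z$, it attains $$\sup_\pi \mathbb E_x^\pi\Big[\tfrac1\gamma \exp\Big(\gamma\sum_{k=0}^\infty\beta^k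 a_k\Big)\Big],$$ the supremum being over all policies. For $\theta\in[\gamma,0)$ let $$J(x,\theta)=\inf_\pi\mathbb E_x^\pi\exp\Big(\theta\sum_{k=0}^\infty\beta^ka_k\Big),\qquad G(x,\theta)=\sum_{k\ge -x}J(x+k,\theta)q_k+\sum_{k<-x}q_k\quad(x\ge0),$$ let $f^*(x,\theta)$ be the largest minimiser over $a\in A(x)$ of $e^{\theta a}G(x-a,\theta\beta)$ if $x\ge0$, and $f^*(x,\theta)=0$ if $x<0$. Let $\pi^*$ be the Markov policy with decision rules $g_n=f^*(\cdot,\gamma\beta^n)$, $n\in\mathbb N_0$, and let $\xi(\theta)=\sup\{x\in\mathbb N_0: f^*(x,\theta)=0\}$. A function $g:\mathbb Z\to\mathbb N_0$ with $g(x)\in A(x)$ is a band-function if there are $N\in\mathbb N_0$ and $c_0,\dots,c_N,d_1,\dots,d_N\in\mathbb N_0$ with $0\le c_0\le d_1\le c_1\le d_2\le\dots\le d_N\le c_N$ and $d_k-c_{k-1}\ge2$ for $k=1,\dots,N$, such that $g(x)=0$ if $x\le c_0$; $g(x)=x-c_k$ if $c_k<x<d_{k+1}$, $0\le k<N$; $g(x)=0$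 if $d_k\le x\le c_k$, $1\le k\le N$; and $g(x)=x-c_N$ if $x>c_N$. Then $\pi^*$ is optimal and it is a band-policy: for every $n\in\mathbb N_0$ the decision rule $f^*(\cdot,\gamma\beta^n)$ is a band-function. Moreover, for every $n\in\mathbb N_0$, $\xi(\gamma\beta^n)<\infty$ and $f^*(x,\gamma\beta^n)=x-\xi(\gamma\beta^n)$ for all integers $x>\xi(\gamma\beta^n)$. -/

import Mathlib

open MeasureTheory
open scoped ENNReal

noncomputable section

namespace Dividend

/-- The dividends `A(x)` available at surplus `x`: `{0, …, x}` if `x ≥ 0`, and `{0}` if `x < 0`. -/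
def actions (x : ℤ) : Finset ℕ := Finset.range (x.toNat + 1)

/-- The set `D` of admissible state-action pairs. -/
abbrev Admissible : Type := {p : ℤ × ℕ // p.2 ∈ actions p.1}

/-- Feasible histories `(x₀, a₀, …, x_{k-1}, a_{k-1}, x_k)`, the elements of `D ^ k × X`. -/
abbrev History (k : ℕ) : Type := (Fin k → Admissible) × ℤ

/-- History-dependent policies: at stage `k` the history `ω_k` is mapped to an action in `A(x_k)`. -/
structure Policy where
  act : ∀ k, History k → ℕ
  act_mem : ∀ k (h : History k), act k h ∈ actions h.2

/-- Decision rules: the class `Γ` of maps `g` with `g x ∈ A(x)`. -/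
abbrev DecisionRule : Type := {g : ℤ → ℕ // ∀ x, g x ∈ actions x}

/-- The policy that a Markov policy `(g_k)`, a sequence of decision rules, amounts to. -/
def Policy.ofMarkov (g : ℕ → DecisionRule) : Policy where
  act k h := (g k).1 h.2
  act_mem k h := (g k).2 h.2

/-- The surplus after paying the dividend `a` at surplus `x` and receiving the income `z`;
after ruin the surplus is frozen. -/
def nextState (x : ℤ) (a : ℕ) (z : ℤ) : ℤ := if 0 ≤ x then x - a + z else x

/-- The history up to stage `k` under the policy `π` started at `x`, when the incomes are
`Z_{k+1} = z k`. -/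
def history (π : Policy) (x : ℤ) (z : ℕ → ℤ) : ∀ k, History k
  | 0 => (Fin.elim0, x)
  | k + 1 =>
    let h := history π x z k
    (Fin.snoc h.1 ⟨(h.2, π.act k h), π.act_mem k h⟩, nextState h.2 (π.act k h) (z k))

/-- The path `(x_k, a_k)_k` under the policy `π` started at `x`, when the incomes are
`Z_{k+1} = z k`. -/
def path (π : Policy) (x : ℤ) (z : ℕ → ℤ) (k : ℕ) : Admissible :=
  ⟨((history π x z k).2, π.act k (history π x z k)), π.act_mem k _⟩

theorem measurable_history (π : Policy) (x : ℤ) (k : ℕ) :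
    Measurable fun z : ℕ → ℤ => history π x z k := by
  induction k with
  | zero => exact measurable_const
  | succ k ih =>
    have h : Measurable fun p : History k × ℤ =>
        ((Fin.snoc p.1.1 ⟨(p.1.2, π.act k p.1), π.act_mem k p.1⟩,
          nextState p.1.2 (π.act k p.1) p.2) : History (k + 1)) := Measurable.of_discrete
    exact h.comp (ih.prodMk (measurable_pi_apply k))

theorem measurable_path (π : Policy) (x : ℤ) : Measurable (path π x) := by
  refine measurable_pi_lambda _ fun k => ?_
  have h : Measurable fun h : History k => (⟨(h.2, π.act k h), π.act_mem k h⟩ : Admissible) :=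
    Measurable.of_discrete
  exact h.comp (measurable_history π x k)

/-- The law `P_x^π` of `(x_k, a_k)_k` on `D ^ ∞`, for i.i.d. incomes with distribution `q`. -/
def pathLaw (q : PMF ℤ) (π : Policy) (x : ℤ) : Measure (ℕ → Admissible) :=
  (Measure.infinitePi fun _ : ℕ => q.toMeasure).map (path π x)

/-- The discounted payoff `∑ β^k a_k`, as an element of `[0, ∞]`. -/
def payoff (β : ℝ) (ω : ℕ → Admissible) : ℝ≥0∞ :=
  ∑' k, ENNReal.ofReal (β ^ k * ((ω k).1.2 : ℝ))

/-- `exp (θ s)` for `θ < 0`, with the limit value `0` at `s = ∞`. -/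
def expMul (θ : ℝ) (s : ℝ≥0∞) : ℝ := if s = ∞ then 0 else Real.exp (θ * s.toReal)

/-- The exponential utility function `U_γ(s) = e^{γ s} / γ`, `γ < 0`. -/
def utility (γ : ℝ) (s : ℝ≥0∞) : ℝ := 1 / γ * expMul γ s

/-- The expected utility of the discounted payoff under `π`, started at `x`. -/
def expectedUtility (q : PMF ℤ) (β γ : ℝ) (π : Policy) (x : ℤ) : ℝ :=
  ∫ ω, utility γ (payoff β ω) ∂(pathLaw q π x)

/-- A policy is optimal if, for every initial surplus, its expected utility is the supremum of the
expected utilities of all history-dependent policies. -/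
def IsOptimal (q : PMF ℤ) (β γ : ℝ) (π : Policy) : Prop :=
  ∀ x : ℤ, IsLUB (Set.range fun π' : Policy => expectedUtility q β γ π' x)
    (expectedUtility q β γ π x)

/-- `J_π(x, θ) = E_x^π exp (θ ∑ β^k a_k)`. -/
def cost (q : PMF ℤ) (β : ℝ) (π : Policy) (x : ℤ) (θ : ℝ) : ℝ :=
  ∫ ω, expMul θ (payoff β ω) ∂(pathLaw q π x)

/-- `J(x, θ) = inf_π J_π(x, θ)`, the infimum over all history-dependent policies. -/
def value (q : PMF ℤ) (β : ℝ) (x : ℤ) (θ : ℝ) : ℝ := ⨅ π : Policy, cost q β π x θ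

/-- `G(x, θ) = ∑_{k ≥ -x} J(x + k, θ) q_k + ∑_{k < -x} q_k`. -/
def G (q : PMF ℤ) (β : ℝ) (x : ℤ) (θ : ℝ) : ℝ :=
  ∑' k : ℤ, (if -x ≤ k then value q β (x + k) θ else 1) * (q k).toReal

open Classical in
/-- The minimisers over `a ∈ A(x)` of `e^{θ a} G(x - a, θ β)`. -/
def minimisers (q : PMF ℤ) (β : ℝ) (x : ℤ) (θ : ℝ) : Finset ℕ :=
  (actions x).filter fun a => ∀ b ∈ actions x,
    Real.exp (θ * a) * G q β (x - a) (θ * β) ≤ Real.exp (θ * b) * G q β (x - b) (θ * β)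

/-- There is always a minimiser, so the maximum in `fStar` is over a non-empty set. -/
theorem minimisers_nonempty (q : PMF ℤ) (β : ℝ) (x : ℤ) (θ : ℝ) :
    (minimisers q β x θ).Nonempty := by
  obtain ⟨a, ha, h⟩ := (actions x).exists_min_image
    (fun a => Real.exp (θ * a) * G q β (x - a) (θ * β)) ⟨0, by simp [actions]⟩
  exact ⟨a, by simpa [minimisers] using ⟨ha, h⟩⟩

/-- `f^*(x, θ)`: the largest minimiser of `e^{θ a} G(x - a, θ β)` over `a ∈ A(x)` if `x ≥ 0`,
and `0` if `x < 0`. -/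
def fStar (q : PMF ℤ) (β : ℝ) (x : ℤ) (θ : ℝ) : ℕ :=
  if 0 ≤ x then (minimisers q β x θ).max' (minimisers_nonempty q β x θ) else 0

theorem fStar_mem (q : PMF ℤ) (β : ℝ) (x : ℤ) (θ : ℝ) : fStar q β x θ ∈ actions x := by
  unfold fStar
  split_ifs with h
  · exact Finset.mem_of_mem_filter _ (Finset.max'_mem _ (minimisers_nonempty q β x θ))
  · simp [actions]

/-- The Markov policy `π^* = (f^*(·, γ), f^*(·, γ β), f^*(·, γ β^2), …)`. -/
def piStar (q : PMF ℤ) (β γ : ℝ) (n : ℕ) : DecisionRule :=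
  ⟨fun x => fStar q β x (γ * β ^ n), fun x => fStar_mem q β x _⟩

/-- The levels `x ∈ ℕ₀` at which `f^*(·, θ)` pays nothing. -/
def zeroLevels (q : PMF ℤ) (β θ : ℝ) : Set ℕ := {x | fStar q β (x : ℤ) θ = 0}

/-- `ξ(θ) = sup {x ∈ ℕ₀ : f^*(x, θ) = 0}`; meaningful when that set is bounded above. -/
def xi (q : PMF ℤ) (β θ : ℝ) : ℕ := sSup (zeroLevels q β θ)

/-- Band-functions, with `n ∈ ℕ₀` and `c₀, …, c_n, d₁, …, d_n ∈ ℕ₀`. -/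
def IsBandFunction (g : DecisionRule) : Prop :=
  ∃ (n : ℕ) (c d : ℕ → ℕ),
    (∀ k, k < n → c k + 2 ≤ d (k + 1) ∧ d (k + 1) ≤ c (k + 1)) ∧
    ∀ x : ℤ,
      (x ≤ c 0 → g.1 x = 0) ∧
      (∀ k, k < n → (c k : ℤ) < x → x < d (k + 1) → (g.1 x : ℤ) = x - c k) ∧
      (∀ k, k < n → (d (k + 1) : ℤ) ≤ x → x ≤ c (k + 1) → g.1 x = 0) ∧
      ((c n : ℤ) < x → (g.1 x : ℤ) = x - c n)

/-- A Markov policy is a band-policy if each of its decision rules is a band-function. -/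
def IsBandPolicy (g : ℕ → DecisionRule) : Prop := ∀ m, IsBandFunction (g m)

end Dividend

end

/-!
The minimal cost `J(x, θ)` is identified by value iteration. The iterates of the Bellman operator on
the constant `1` decrease to a function `limitValue`, which by dominated convergence solves the
Bellman equation (`bellman_limitValue`). For an arbitrary policy the expectation of
`exp (θ · payoff before stage k) · limitValue (θ β ^ k) x_k` is nondecreasing in `k`, since the
income `Z_{k+1}` is independent of the history up to stage `k`; hence `limitValue` is a lower bound
for every cost (`limitValue_le_cost`). If all decision rules attain the minimum in the Bellman
equation, this expectation is constant. Jensen's inequality gives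
`exp (θ (x⁺ + C)) ≤ limitValue θ x` with the constant `C = gainBound q β`, and the surplus grows at
most linearly in the mean, so the continuation value at stage `k` tends to `1` and the cost equals
`limitValue` (`cost_of_isMinimising`). Therefore `J = limitValue`, the rules `f^*` are minimising,
and `π^*` is optimal.

For the band structure, a dividend `a` at surplus `x` is described by the level `y = x - a` that it
leaves. Up to the factor `exp (θ x)`, its cost is `levelCost y = exp (-θ y) G(y, θ β)`, which does
not depend on `x`. The largest minimiser `f^*(x, θ)` thus leaves the last strict record low of
`levelCost` on `{0, …, x}`, and the levels at which `f^*` pays nothing are exactly the record times.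
Every set of naturals that contains `0` and is bounded is a finite union of maximal intervals, and
this alone makes `f^*` a band-function as soon as the set of records is bounded
(`exists_bands`, `isBandFunction_fStar`). It is bounded because the lower bound above makes
`levelCost` grow at least like `exp (-θ (1 - β) y)` (`le_of_mem_zeroLevels`).
-/

noncomputable section

namespace Dividend

/-! ### Surpluses and actions -/

theorem zero_mem_actions (x : ℤ) : 0 ∈ actions x := by simp [actions]

theorem actions_nonempty (x : ℤ) : (actions x).Nonempty := ⟨0, zero_mem_actions x⟩

/-- The positive part of the surplus, as a real number. -/
def posPart (x : ℤ) : ℝ := ((max x 0 : ℤ) : ℝ)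

theorem posPart_nonneg (x : ℤ) : 0 ≤ posPart x := by
  unfold posPart; exact_mod_cast le_max_right x 0

theorem le_posPart_of_mem_actions {x : ℤ} {a : ℕ} (ha : a ∈ actions x) : (a : ℝ) ≤ posPart x := by
  have h : (a : ℤ) ≤ max x 0 := by
    simp only [actions, Finset.mem_range] at ha
    omega
  unfold posPart; exact_mod_cast h

theorem posPart_nextState_le {x : ℤ} {a : ℕ} (ha : a ∈ actions x) (z : ℤ) :
    posPart (nextState x a z) ≤ posPart x - a + posPart z := by
  have h : max (nextState x a z) 0 ≤ max x 0 - a + max z 0 := by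
    simp only [actions, Finset.mem_range] at ha
    unfold nextState
    split_ifs <;> omega
  unfold posPart; exact_mod_cast h

/-! ### Value iteration -/

/-- The expected value of `v` after the action `a` at surplus `x`. -/
def expNext (q : PMF ℤ) (v : ℤ → ℝ) (x : ℤ) (a : ℕ) : ℝ := ∫ z, v (nextState x a z) ∂q.toMeasure

theorem integrable_of_mem_Icc {α : Type*} [MeasurableSpace α] {μ : Measure α}
    [IsFiniteMeasure μ] {f : α → ℝ} (hm : Measurable f) (h : ∀ z, f z ∈ Set.Icc (0 : ℝ) 1) :
    Integrable f μ :=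
  Integrable.of_bound hm.aestronglyMeasurable 1
    (Filter.Eventually.of_forall fun z => by
      rw [Real.norm_eq_abs, abs_of_nonneg (h z).1]; exact (h z).2)

theorem expNext_mono (q : PMF ℤ) {v w : ℤ → ℝ} (hv : ∀ x, v x ∈ Set.Icc (0 : ℝ) 1)
    (hw : ∀ x, w x ∈ Set.Icc (0 : ℝ) 1) (h : ∀ x, v x ≤ w x) (x : ℤ) (a : ℕ) :
    expNext q v x a ≤ expNext q w x a :=
  integral_mono (integrable_of_mem_Icc .of_discrete fun _ => hv _)
    (integrable_of_mem_Icc .of_discrete fun _ => hw _) fun _ => h _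

theorem expNext_mem_Icc (q : PMF ℤ) {v : ℤ → ℝ} (hv : ∀ x, v x ∈ Set.Icc (0 : ℝ) 1)
    (x : ℤ) (a : ℕ) : expNext q v x a ∈ Set.Icc (0 : ℝ) 1 := by
  refine ⟨integral_nonneg fun z => (hv _).1, ?_⟩
  have := expNext_mono q hv (w := fun _ => 1) (by simp) (fun x => (hv x).2) x a
  simpa [expNext] using this

/-- The Bellman operator, acting on functions of the risk parameter `θ` and of the surplus. -/
def bellman (q : PMF ℤ) (β : ℝ) (v : ℝ → ℤ → ℝ) (θ : ℝ) (x : ℤ) : ℝ :=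
  (actions x).inf' (actions_nonempty x) fun a => Real.exp (θ * a) * expNext q (v (θ * β)) x a

theorem bellman_le {q : PMF ℤ} {β : ℝ} {v : ℝ → ℤ → ℝ} {θ : ℝ} {x : ℤ} {a : ℕ}
    (ha : a ∈ actions x) :
    bellman q β v θ x ≤ Real.exp (θ * a) * expNext q (v (θ * β)) x a :=
  Finset.inf'_le (fun a : ℕ => Real.exp (θ * a) * expNext q (v (θ * β)) x a) ha

theorem le_bellman {q : PMF ℤ} {β : ℝ} {v : ℝ → ℤ → ℝ} {θ r : ℝ} {x : ℤ}
    (h : ∀ a ∈ actions x, r ≤ Real.exp (θ * a) * expNext q (v (θ * β)) x a) :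
    r ≤ bellman q β v θ x :=
  Finset.le_inf' _ _ h

/-- The iterates of the Bellman operator on the constant `1`: the optimal costs of the
finite-horizon problems. -/
def iterValue (q : PMF ℤ) (β : ℝ) : ℕ → ℝ → ℤ → ℝ
  | 0 => fun _ _ => 1
  | n + 1 => bellman q β (iterValue q β n)

/-- The limit of value iteration, written as an infimum because the iterates decrease. -/
def limitValue (q : PMF ℤ) (β θ : ℝ) (x : ℤ) : ℝ := ⨅ n, iterValue q β n θ x

variable {q : PMF ℤ} {β θ : ℝ}

theorem exp_mul_natCast_le_one (hθ : θ ≤ 0) (a : ℕ) : Real.exp (θ * a) ≤ 1 :=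
  Real.exp_le_one_iff.2 (mul_nonpos_of_nonpos_of_nonneg hθ a.cast_nonneg)

theorem iterValue_mem_Icc (hβ : 0 ≤ β) (n : ℕ) (hθ : θ ≤ 0) (x : ℤ) :
    iterValue q β n θ x ∈ Set.Icc (0 : ℝ) 1 := by
  induction n generalizing θ x with
  | zero => simp [iterValue]
  | succ n ih =>
    have hθ' : θ * β ≤ 0 := mul_nonpos_of_nonpos_of_nonneg hθ hβ
    have hE := expNext_mem_Icc q (fun y => ih hθ' y) x
    constructor
    · exact le_bellman fun a _ => mul_nonneg (Real.exp_pos _).le (hE a).1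
    · refine (bellman_le (zero_mem_actions x)).trans ?_
      simpa using (hE 0).2

theorem iterValue_succ_le (hβ : 0 ≤ β) (n : ℕ) (hθ : θ ≤ 0) (x : ℤ) :
    iterValue q β (n + 1) θ x ≤ iterValue q β n θ x := by
  induction n generalizing θ x with
  | zero => exact (iterValue_mem_Icc hβ 1 hθ x).2
  | succ n ih =>
    have hθ' : θ * β ≤ 0 := mul_nonpos_of_nonpos_of_nonneg hθ hβ
    refine le_bellman fun a ha => (bellman_le ha).trans ?_
    exact mul_le_mul_of_nonneg_left (expNext_mono q (fun y => iterValue_mem_Icc hβ _ hθ' y)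
      (fun y => iterValue_mem_Icc hβ _ hθ' y) (fun y => ih hθ' y) x a) (Real.exp_pos _).le

theorem bddBelow_iterValue (hβ : 0 ≤ β) (hθ : θ ≤ 0) (x : ℤ) :
    BddBelow (Set.range fun n => iterValue q β n θ x) :=
  ⟨0, by rintro _ ⟨n, rfl⟩; exact (iterValue_mem_Icc hβ n hθ x).1⟩

theorem limitValue_le (hβ : 0 ≤ β) (hθ : θ ≤ 0) (n : ℕ) (x : ℤ) :
    limitValue q β θ x ≤ iterValue q β n θ x :=
  ciInf_le (bddBelow_iterValue hβ hθ x) n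

theorem limitValue_mem_Icc (hβ : 0 ≤ β) (hθ : θ ≤ 0) (x : ℤ) :
    limitValue q β θ x ∈ Set.Icc (0 : ℝ) 1 :=
  ⟨le_ciInf fun n => (iterValue_mem_Icc hβ n hθ x).1,
    (limitValue_le hβ hθ 0 x).trans (iterValue_mem_Icc hβ 0 hθ x).2⟩

theorem limitValue_of_neg {x : ℤ} (hx : x < 0) : limitValue q β θ x = 1 := by
  have h : ∀ n θ, iterValue q β n θ x = 1 := by
    intro n
    induction n with
    | zero => intro θ; rfl
    | succ n ih =>
      intro θ
      have ha : actions x = {0} := by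
        simp [actions, Int.toNat_of_nonpos hx.le]
      simp [iterValue, bellman, ha, expNext, nextState, hx.not_ge, ih]
  simp [limitValue, h]

theorem tendsto_expNext_iterValue (hβ : 0 ≤ β) (hθ : θ ≤ 0) (x : ℤ) (a : ℕ) :
    Filter.Tendsto (fun n => expNext q (iterValue q β n θ) x a) Filter.atTop
      (nhds (expNext q (limitValue q β θ) x a)) := by
  refine tendsto_integral_of_dominated_convergence (fun _ => (1 : ℝ))
    (fun n => Measurable.of_discrete.aestronglyMeasurable) (integrable_const _)
    (fun n => Filter.Eventually.of_forall fun z => ?_)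
    (Filter.Eventually.of_forall fun z => ?_)
  · have := iterValue_mem_Icc (q := q) hβ n hθ (nextState x a z)
    rw [Real.norm_eq_abs, abs_of_nonneg this.1]; exact this.2
  · exact tendsto_atTop_ciInf
      (antitone_nat_of_succ_le fun n => iterValue_succ_le hβ n hθ _) (bddBelow_iterValue hβ hθ _)

theorem limitValue_le_exp_mul (hβ : 0 ≤ β) (hθ : θ ≤ 0) {x : ℤ} {a : ℕ} (ha : a ∈ actions x) :
    limitValue q β θ x ≤ Real.exp (θ * a) * expNext q (limitValue q β (θ * β)) x a := by
  have hθ' : θ * β ≤ 0 := mul_nonpos_of_nonpos_of_nonneg hθ hβ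
  refine ge_of_tendsto' ((tendsto_expNext_iterValue hβ hθ' x a).const_mul _) fun n => ?_
  exact (limitValue_le hβ hθ (n + 1) x).trans (bellman_le ha)

/-- The limit of value iteration is a fixed point of the Bellman operator. -/
theorem bellman_limitValue (hβ : 0 ≤ β) (hθ : θ ≤ 0) (x : ℤ) :
    bellman q β (limitValue q β) θ x = limitValue q β θ x := by
  have hθ' : θ * β ≤ 0 := mul_nonpos_of_nonpos_of_nonneg hθ hβ
  refine le_antisymm (le_ciInf fun n => ?_)
    (le_bellman fun a ha => limitValue_le_exp_mul hβ hθ ha)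
  refine le_trans (le_bellman fun a ha => (bellman_le ha).trans ?_)
    (iterValue_succ_le hβ n hθ x)
  exact mul_le_mul_of_nonneg_left (expNext_mono q (fun y => limitValue_mem_Icc hβ hθ' y)
    (fun y => iterValue_mem_Icc hβ n hθ' y) (fun y => limitValue_le hβ hθ' n y) x a)
    (Real.exp_pos _).le

/-- The mean `E Z⁺` of the positive part of the income. -/
def meanPos (q : PMF ℤ) : ℝ := ∫ z, posPart z ∂q.toMeasure

theorem meanPos_nonneg (q : PMF ℤ) : 0 ≤ meanPos q := integral_nonneg posPart_nonneg

/-- The expectation `∑_{k ≥ 1} β ^ k E Z⁺` of all discounted future gains. -/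
def gainBound (q : PMF ℤ) (β : ℝ) : ℝ := β * meanPos q / (1 - β)

theorem gainBound_nonneg (hβ0 : 0 ≤ β) (hβ1 : β < 1) : 0 ≤ gainBound q β :=
  div_nonneg (mul_nonneg hβ0 (meanPos_nonneg q)) (by linarith)

theorem gainBound_eq (hβ1 : β < 1) : β * (meanPos q + gainBound q β) = gainBound q β := by
  have : 1 - β ≠ 0 := by linarith
  unfold gainBound
  field_simp
  ring

/-- Jensen's inequality carries an exponential lower bound on the continuation value through one
period, in which the surplus rises by at most `E Z⁺` on average. -/
theorem exp_le_expNext (hq : Integrable posPart q.toMeasure) (hθ : θ ≤ 0) {v : ℤ → ℝ}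
    (hv : ∀ y, v y ∈ Set.Icc (0 : ℝ) 1) {B : ℝ} (hB : 0 ≤ B)
    (h : ∀ y, Real.exp (θ * (posPart y + B)) ≤ v y) {x : ℤ} {a : ℕ} (ha : a ∈ actions x) :
    Real.exp (θ * (posPart x - a + meanPos q + B)) ≤ expNext q v x a := by
  have hax := le_posPart_of_mem_actions ha
  set C : ℝ := posPart x - a + B with hC
  have hC0 : 0 ≤ C := add_nonneg (by linarith) hB
  have hf : Integrable (fun z => θ * (C + posPart z)) q.toMeasure :=
    ((integrable_const C).add hq).const_mul _
  have hexp : Integrable (fun z => Real.exp (θ * (C + posPart z))) q.toMeasure :=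
    integrable_of_mem_Icc .of_discrete fun z => ⟨(Real.exp_pos _).le, Real.exp_le_one_iff.2
      (mul_nonpos_of_nonpos_of_nonneg hθ (add_nonneg hC0 (posPart_nonneg z)))⟩
  have hmean : ∫ z, θ * (C + posPart z) ∂q.toMeasure =
      θ * (posPart x - a + meanPos q + B) := by
    rw [integral_const_mul, integral_add (integrable_const C) hq]
    simp only [integral_const, probReal_univ, one_smul, hC, meanPos]
    ring
  rw [← hmean]
  refine (convexOn_exp.map_integral_le Real.continuous_exp.continuousOn isClosed_univ
    (by simp) hf hexp).trans (integral_mono hexp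
    (integrable_of_mem_Icc .of_discrete fun z => hv _) fun z => ?_)
  refine le_trans (Real.exp_le_exp.2 (mul_le_mul_of_nonpos_left ?_ hθ)) (h _)
  linarith [posPart_nextState_le ha z]

/-- The payoff from surplus `x` has mean at most `x⁺ + gainBound q β`, so by Jensen's inequality the
cost is at least the exponential of `θ` times that bound. -/
theorem exp_le_iterValue (hβ0 : 0 ≤ β) (hβ1 : β < 1) (hq : Integrable posPart q.toMeasure) (n : ℕ)
    (hθ : θ ≤ 0) (x : ℤ) :
    Real.exp (θ * (posPart x + gainBound q β)) ≤ iterValue q β n θ x := by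
  induction n generalizing θ x with
  | zero =>
    exact Real.exp_le_one_iff.2 (mul_nonpos_of_nonpos_of_nonneg hθ
      (add_nonneg (posPart_nonneg x) (gainBound_nonneg hβ0 hβ1)))
  | succ n ih =>
    have hθ' : θ * β ≤ 0 := mul_nonpos_of_nonpos_of_nonneg hθ hβ0
    refine le_bellman fun a ha => ?_
    have hax := le_posPart_of_mem_actions ha
    refine le_trans ?_ (mul_le_mul_of_nonneg_left (exp_le_expNext hq hθ'
      (fun y => iterValue_mem_Icc hβ0 n hθ' y) (gainBound_nonneg hβ0 hβ1) (fun y => ih hθ' y) ha)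
      (Real.exp_pos _).le)
    rw [← Real.exp_add, Real.exp_le_exp]
    have hg := gainBound_eq (q := q) hβ1
    have h1 : a + β * (posPart x - a + meanPos q + gainBound q β) ≤ posPart x + gainBound q β := by
      have : β * (posPart x - a) ≤ posPart x - a := mul_le_of_le_one_left (by linarith) hβ1.le
      linarith
    calc θ * (posPart x + gainBound q β)
        ≤ θ * (a + β * (posPart x - a + meanPos q + gainBound q β)) :=
          mul_le_mul_of_nonpos_left h1 hθ
      _ = _ := by ring

theorem exp_le_limitValue (hβ0 : 0 ≤ β) (hβ1 : β < 1) (hq : Integrable posPart q.toMeasure)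
    (hθ : θ ≤ 0) (x : ℤ) :
    Real.exp (θ * (posPart x + gainBound q β)) ≤ limitValue q β θ x :=
  le_ciInf fun n => exp_le_iterValue hβ0 hβ1 hq n hθ x

/-! ### Band structure of eventually constant records -/

/-- The hypotheses say that `y x` is the last fixed point of `y` that is at most `x`. Up to any level
`N` the fixed points then form finitely many intervals separated by gaps: `[0, c 0]` and
`[d k, c k]` for `1 ≤ k ≤ n`, where the last one is cut off at `N`. -/
theorem exists_bands {y : ℕ → ℕ} (h0 : y 0 = 0)
    (hy : ∀ x, y (x + 1) = x + 1 ∨ y (x + 1) = y x) (N : ℕ) :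
    ∃ (n : ℕ) (c d : ℕ → ℕ),
      (∀ k, k < n → c k + 2 ≤ d (k + 1) ∧ d (k + 1) ≤ c (k + 1)) ∧ c n = y N ∧
      (∀ k ≤ n, c k ≤ N) ∧
      ∀ x ≤ N,
        (x ≤ c 0 → y x = x) ∧
        (∀ k, k < n → c k < x → x < d (k + 1) → y x = c k) ∧
        (∀ k, k < n → d (k + 1) ≤ x → x ≤ c (k + 1) → y x = x) ∧
        (c n < x → y x = c n) := by
  induction N with
  | zero => exact ⟨0, fun _ => 0, fun _ => 0, by simp, h0.symm, by simp, by simp [h0]⟩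
  | succ N ih =>
    obtain ⟨n, c, d, hcd, hc, hcN, hx⟩ := ih
    rcases hy N with hN | hN
    · by_cases hn : c n = N
      · -- the last interval `[d n, N]` is prolonged by `N + 1` (`[0, N]` if `n = 0`)
        refine ⟨n, fun k => if k = n then N + 1 else c k, d, fun k hk => ?_, by simp [hN],
          fun k hk => ?_, fun x hxN => ?_⟩
        · have := hcd k hk
          simp only [hk.ne, if_false]
          split_ifs with h
          · subst h; omega
          · exact this
        · have := hcN k hk
          dsimp only; split_ifs <;> omega
        · dsimp only
          rcases Nat.lt_or_ge N x with h | h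
          · obtain rfl : x = N + 1 := by omega
            refine ⟨fun _ => hN, fun k hk _ h2 => ?_, fun _ _ _ _ => hN, fun h => ?_⟩
            · have := hcd k hk
              have := hcN (k + 1) hk
              omega
            · simp at h
          · obtain ⟨h1, h2, h3, h4⟩ := hx x h
            refine ⟨fun hx0 => ?_, fun k hk => ?_, fun k hk hd hxc => ?_, fun h => ?_⟩
            · split_ifs at hx0 with h0n
              · subst h0n; exact h1 (by omega)
              · exact h1 hx0
            · simpa [hk.ne] using h2 k hk
            · split_ifs at hxc with hkn
              · subst hkn; exact h3 k hk hd (by omega)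
              · exact h3 k hk hd hxc
            · simp at h; omega
      · -- a new interval starts at `N + 1`
        have hnN : c n < N := lt_of_le_of_ne (hcN n le_rfl) hn
        refine ⟨n + 1, fun k => if k = n + 1 then N + 1 else c k,
          fun k => if k = n + 1 then N + 1 else d k, fun k hk => ?_, by simp [hN],
          fun k hk => ?_, fun x hxN => ?_⟩
        · simp only [hk.ne, if_false]
          by_cases h : k = n
          · subst h; simp; omega
          · have := hcd k (by omega)
            simpa [h] using this
        · dsimp only; split_ifs with h
          · omega
          · have := hcN k (by omega)
            omega
        · dsimp only
          rcases Nat.lt_or_ge N x with h | h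
          · obtain rfl : x = N + 1 := by omega
            refine ⟨fun _ => hN, fun k hk _ h2 => ?_, fun _ _ _ _ => hN, fun h => ?_⟩
            · split_ifs at h2 with hk'
              · omega
              · have := hcd k (by omega)
                have := hcN (k + 1) (by omega)
                omega
            · simp at h
          · obtain ⟨h1, h2, h3, h4⟩ := hx x h
            refine ⟨fun hx0 => h1 (by simpa using hx0), fun k hk hl hr => ?_,
              fun k hk hd hxc => ?_, fun h => ?_⟩
            · simp only [hk.ne, if_false] at hl ⊢
              by_cases hkn : k = n
              · subst hkn; exact h4 hl
              · exact h2 k (by omega) hl (by simpa [hkn] using hr)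
            · by_cases hkn : k = n
              · subst hkn; simp at hd; omega
              · simp only [Nat.add_right_cancel_iff, hkn, if_false] at hd hxc
                exact h3 k (by omega) hd hxc
            · simp at h; omega
    · refine ⟨n, c, d, hcd, by rw [hN, hc], fun k hk => (hcN k hk).trans (by omega),
        fun x hxN => ?_⟩
      rcases Nat.lt_or_ge N x with h | h
      · obtain rfl : x = N + 1 := by omega
        refine ⟨fun h => ?_, fun k hk _ h2 => ?_, fun k hk _ h2 => ?_, fun _ => by rw [hN, hc]⟩
        · have := hcN 0 (by omega); omega
        · have := hcd k hk
          have := hcN (k + 1) hk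
          omega
        · have := hcN (k + 1) hk
          omega
      · exact hx x h

/-! ### The law of the histories -/

/-- The joint law of the incomes. -/
def incomeLaw (q : PMF ℤ) : Measure (ℕ → ℤ) := Measure.infinitePi fun _ : ℕ => q.toMeasure

instance (q : PMF ℤ) : IsProbabilityMeasure (incomeLaw q) := by
  unfold incomeLaw; infer_instance

theorem history_congr (π : Policy) (x : ℤ) {z w : ℕ → ℤ} {k : ℕ} (h : ∀ i < k, z i = w i) :
    history π x z k = history π x w k := by
  induction k with
  | zero => rfl
  | succ k ih => simp only [history, ih fun i hi => h i (by omega), h k (by omega)]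

theorem indepFun_history (q : PMF ℤ) (π : Policy) (x : ℤ) (k : ℕ) :
    ProbabilityTheory.IndepFun (fun z => history π x z k) (fun z => z k) (incomeLaw q) := by
  have hi : ProbabilityTheory.iIndepFun (fun (i : ℕ) (z : ℕ → ℤ) => z i) (incomeLaw q) :=
    ProbabilityTheory.iIndepFun_infinitePi (X := fun _ z => z) fun _ => measurable_id
  have h := hi.indepFun_finset (Finset.range k) {k} (by simp) fun i => measurable_pi_apply i
  -- the history up to stage `k` does not change when the incomes from `k` on are set to `0`
  let ext : (Finset.range k → ℤ) → ℕ → ℤ :=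
    fun u i => if hi : i ∈ Finset.range k then u ⟨i, hi⟩ else 0
  have hext : Measurable ext := by
    refine measurable_pi_lambda _ fun i => ?_
    by_cases hi : i ∈ Finset.range k
    · simpa only [ext, dif_pos hi] using
        measurable_pi_apply (⟨i, hi⟩ : Finset.range k)
    · simp only [ext, dif_neg hi]
      exact measurable_const
  have h2 := h.comp (φ := fun u => history π x (ext u) k)
    (ψ := fun u => u ⟨k, Finset.mem_singleton_self k⟩)
    ((measurable_history π x k).comp hext)
    (measurable_pi_apply (X := fun _ => ℤ) _)
  have he : (fun z : ℕ → ℤ => history π x z k) =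
      (fun u => history π x (ext u) k) ∘ fun z (i : Finset.range k) => z i := by
    funext z
    exact history_congr π x fun i hi => by simp [ext, hi]
  rw [he]
  exact h2

/-- Given the history up to stage `k`, the next income has law `q`. -/
theorem integral_history_income (q : PMF ℤ) (π : Policy) (x : ℤ) (k : ℕ) {F : History k × ℤ → ℝ}
    (hF : Integrable (fun z => F (history π x z k, z k)) (incomeLaw q)) :
    ∫ z, F (history π x z k, z k) ∂incomeLaw q =
      ∫ z, ∫ y, F (history π x z k, y) ∂q.toMeasure ∂incomeLaw q := by
  have hH := measurable_history π x k
  have hk : Measurable fun z : ℕ → ℤ => z k := measurable_pi_apply k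
  have hmap : (incomeLaw q).map (fun z => (history π x z k, z k)) =
      ((incomeLaw q).map fun z => history π x z k).prod q.toMeasure := by
    have h := (ProbabilityTheory.indepFun_iff_map_prod_eq_prod_map_map hH.aemeasurable
      hk.aemeasurable).1 (indepFun_history q π x k)
    rw [h]
    congr 1
    exact Measure.infinitePi_map_eval _ k
  have hP : IsProbabilityMeasure ((incomeLaw q).map fun z => history π x z k) :=
    Measure.isProbabilityMeasure_map hH.aemeasurable
  have hFm : Measurable F := Measurable.of_discrete
  have hF' : Integrable F (((incomeLaw q).map fun z => history π x z k).prod q.toMeasure) := by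
    rw [← hmap]
    exact (integrable_map_measure hFm.aestronglyMeasurable (hH.prodMk hk).aemeasurable).2 hF
  calc ∫ z, F (history π x z k, z k) ∂incomeLaw q
      = ∫ p, F p ∂(incomeLaw q).map fun z => (history π x z k, z k) :=
        (integral_map (hH.prodMk hk).aemeasurable hFm.aestronglyMeasurable).symm
    _ = ∫ h, ∫ y, F (h, y) ∂q.toMeasure ∂(incomeLaw q).map fun z => history π x z k := by
        rw [hmap, integral_prod _ hF']
    _ = _ := integral_map hH.aemeasurable Measurable.of_discrete.aestronglyMeasurable

/-! ### The accrued payoff -/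

/-- The discounted dividends paid before stage `k`. -/
def accrued (β : ℝ) {k : ℕ} (h : History k) : ℝ := ∑ i : Fin k, β ^ (i : ℕ) * ((h.1 i).1.2 : ℝ)

theorem accrued_nonneg (hβ : 0 ≤ β) {k : ℕ} (h : History k) : 0 ≤ accrued β h :=
  Finset.sum_nonneg fun _ _ => mul_nonneg (pow_nonneg hβ _) (Nat.cast_nonneg _)

theorem accrued_history_succ (β : ℝ) (π : Policy) (x : ℤ) (z : ℕ → ℤ) (k : ℕ) :
    accrued β (history π x z (k + 1)) =
      accrued β (history π x z k) + β ^ k * (π.act k (history π x z k) : ℝ) := by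
  simp [accrued, history, Fin.sum_univ_castSucc]

theorem accrued_history (β : ℝ) (π : Policy) (x : ℤ) (z : ℕ → ℤ) (k : ℕ) :
    accrued β (history π x z k) =
      ∑ i ∈ Finset.range k, β ^ i * ((path π x z i).1.2 : ℝ) := by
  induction k with
  | zero => simp [accrued]
  | succ k ih => rw [accrued_history_succ, ih, Finset.sum_range_succ]; rfl

theorem exp_accrued_mem_Icc (hβ : 0 ≤ β) (hθ : θ ≤ 0) {k : ℕ} (h : History k) :
    Real.exp (θ * accrued β h) ∈ Set.Icc (0 : ℝ) 1 :=
  ⟨(Real.exp_pos _).le, Real.exp_le_one_iff.2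
    (mul_nonpos_of_nonpos_of_nonneg hθ (accrued_nonneg hβ h))⟩

theorem tendsto_exp_accrued (hβ : 0 ≤ β) (hθ : θ < 0) (π : Policy) (x : ℤ) (z : ℕ → ℤ) :
    Filter.Tendsto (fun k => Real.exp (θ * accrued β (history π x z k))) Filter.atTop
      (nhds (expMul θ (payoff β (path π x z)))) := by
  set u : ℕ → ℝ := fun i => β ^ i * ((path π x z i).1.2 : ℝ) with hu
  have hu0 : ∀ i, 0 ≤ u i := fun i => mul_nonneg (pow_nonneg hβ _) (Nat.cast_nonneg _)
  simp only [accrued_history]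
  change Filter.Tendsto (fun k => Real.exp (θ * ∑ i ∈ Finset.range k, u i)) _
    (nhds (expMul θ (∑' i, ENNReal.ofReal (u i))))
  unfold expMul
  split_ifs with h
  · have hns : ¬ Summable u := fun hs => hs.tsum_ofReal_ne_top h
    have := (not_summable_iff_tendsto_nat_atTop_of_nonneg hu0).1 hns
    exact Real.tendsto_exp_atBot.comp (this.const_mul_atTop_of_neg hθ)
  · have hs : Summable u := by
      have := ENNReal.summable_toReal h
      simpa [ENNReal.toReal_ofReal (hu0 _)] using this
    rw [← ENNReal.ofReal_tsum_of_nonneg hu0 hs, ENNReal.toReal_ofReal (tsum_nonneg hu0)]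
    exact (Real.continuous_exp.tendsto _).comp (hs.hasSum.tendsto_sum_nat.const_mul θ)

theorem measurable_payoff (β : ℝ) : Measurable (payoff β) := by
  refine Measurable.tsum fun k => ?_
  have h : Measurable fun p : Admissible => ENNReal.ofReal (β ^ k * (p.1.2 : ℝ)) :=
    Measurable.of_discrete
  exact h.comp (measurable_pi_apply k)

theorem measurable_expMul (θ : ℝ) : Measurable (expMul θ) :=
  Measurable.ite (measurableSet_singleton ∞) measurable_const
    (Real.measurable_exp.comp (ENNReal.measurable_toReal.const_mul θ))

theorem cost_eq_integral (q : PMF ℤ) (β : ℝ) (π : Policy) (x : ℤ) (θ : ℝ) :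
    cost q β π x θ = ∫ z, expMul θ (payoff β (path π x z)) ∂incomeLaw q :=
  integral_map (measurable_path π x).aemeasurable
    ((measurable_expMul θ).comp (measurable_payoff β)).aestronglyMeasurable

theorem measurable_comp_history (π : Policy) (x : ℤ) (k : ℕ) (f : History k → ℝ) :
    Measurable fun z => f (history π x z k) :=
  (Measurable.of_discrete (f := f)).comp (measurable_history π x k)

theorem tendsto_integral_exp_accrued (hβ : 0 ≤ β) (hθ : θ < 0) (q : PMF ℤ) (π : Policy) (x : ℤ) :
    Filter.Tendsto (fun k => ∫ z, Real.exp (θ * accrued β (history π x z k)) ∂incomeLaw q)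
      Filter.atTop (nhds (cost q β π x θ)) := by
  rw [cost_eq_integral]
  refine tendsto_integral_of_dominated_convergence (fun _ => (1 : ℝ)) (fun k =>
      (measurable_comp_history π x k fun h => Real.exp (θ * accrued β h)).aestronglyMeasurable)
    (integrable_const _) (fun k => Filter.Eventually.of_forall fun z => ?_)
    (Filter.Eventually.of_forall fun z => tendsto_exp_accrued hβ hθ π x z)
  have := exp_accrued_mem_Icc hβ hθ.le (history π x z k)
  rw [Real.norm_eq_abs, abs_of_nonneg this.1]; exact this.2

/-! ### Verification -/

/-- The cost of following `π` up to stage `k` and continuing optimally from there on. -/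
def stageValue (q : PMF ℤ) (β θ : ℝ) (π : Policy) (x : ℤ) (k : ℕ) : ℝ :=
  ∫ z, Real.exp (θ * accrued β (history π x z k)) *
    limitValue q β (θ * β ^ k) (history π x z k).2 ∂incomeLaw q

theorem mul_pow_nonpos (hβ : 0 ≤ β) (hθ : θ ≤ 0) (k : ℕ) : θ * β ^ k ≤ 0 :=
  mul_nonpos_of_nonpos_of_nonneg hθ (pow_nonneg hβ k)

theorem stageIntegrand_mem_Icc (hβ : 0 ≤ β) (hθ : θ ≤ 0) {k : ℕ} (h : History k) :
    Real.exp (θ * accrued β h) * limitValue q β (θ * β ^ k) h.2 ∈ Set.Icc (0 : ℝ) 1 := by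
  have h1 := exp_accrued_mem_Icc hβ hθ h
  have h2 := limitValue_mem_Icc (q := q) hβ (mul_pow_nonpos hβ hθ k) h.2
  exact ⟨mul_nonneg h1.1 h2.1, mul_le_one₀ h1.2 h2.1 h2.2⟩

theorem stageValue_zero (q : PMF ℤ) (β θ : ℝ) (π : Policy) (x : ℤ) :
    stageValue q β θ π x 0 = limitValue q β θ x := by
  simp [stageValue, history, accrued]

theorem integrable_stage (hβ : 0 ≤ β) (hθ : θ ≤ 0) (π : Policy) (x : ℤ) (k : ℕ) :
    Integrable (fun z => Real.exp (θ * accrued β (history π x z k)) *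
      limitValue q β (θ * β ^ k) (history π x z k).2) (incomeLaw q) :=
  integrable_of_mem_Icc
    (measurable_comp_history π x k fun h =>
      Real.exp (θ * accrued β h) * limitValue q β (θ * β ^ k) h.2)
    fun z => stageIntegrand_mem_Icc hβ hθ (history π x z k)

theorem stageValue_succ (hβ : 0 ≤ β) (hθ : θ ≤ 0) (π : Policy) (x : ℤ) (k : ℕ) :
    stageValue q β θ π x (k + 1) = ∫ z, Real.exp (θ * accrued β (history π x z k)) *
      (Real.exp (θ * β ^ k * π.act k (history π x z k)) *
        expNext q (limitValue q β (θ * β ^ k * β)) (history π x z k).2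
          (π.act k (history π x z k))) ∂incomeLaw q := by
  have hi := integrable_stage (q := q) hβ hθ π x (k + 1)
  let F : History k × ℤ → ℝ := fun p =>
    Real.exp (θ * accrued β p.1) * (Real.exp (θ * β ^ k * π.act k p.1) *
      limitValue q β (θ * β ^ k * β) (nextState p.1.2 (π.act k p.1) p.2))
  have he : ∀ z : ℕ → ℤ, Real.exp (θ * accrued β (history π x z (k + 1))) *
      limitValue q β (θ * β ^ (k + 1)) (history π x z (k + 1)).2 =
      F (history π x z k, z k) := by
    intro z
    rw [accrued_history_succ, mul_add, Real.exp_add, pow_succ]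
    simp only [F, history, mul_assoc]
  unfold stageValue
  simp only [he] at hi ⊢
  rw [integral_history_income q π x k hi]
  simp only [F, integral_const_mul, expNext]

theorem stageValue_le_succ (hβ : 0 ≤ β) (hθ : θ ≤ 0) (π : Policy) (x : ℤ) (k : ℕ) :
    stageValue q β θ π x k ≤ stageValue q β θ π x (k + 1) := by
  rw [stageValue_succ hβ hθ]
  have hθk := mul_pow_nonpos hβ hθ k
  refine integral_mono (integrable_stage hβ hθ π x k) (integrable_of_mem_Icc
    (measurable_comp_history π x k fun h => Real.exp (θ * accrued β h) *
      (Real.exp (θ * β ^ k * π.act k h) *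
        expNext q (limitValue q β (θ * β ^ k * β)) h.2 (π.act k h))) fun z => ?_) fun z => ?_
  · have h1 := exp_accrued_mem_Icc hβ hθ (history π x z k)
    have h2 := expNext_mem_Icc q (fun y => limitValue_mem_Icc (q := q) hβ
      (mul_nonpos_of_nonpos_of_nonneg hθk hβ) y) (history π x z k).2 (π.act k (history π x z k))
    have h3 := exp_mul_natCast_le_one hθk (π.act k (history π x z k))
    exact ⟨mul_nonneg h1.1 (mul_nonneg (Real.exp_pos _).le h2.1),
      mul_le_one₀ h1.2 (mul_nonneg (Real.exp_pos _).le h2.1) (mul_le_one₀ h3 h2.1 h2.2)⟩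
  · exact mul_le_mul_of_nonneg_left
      (limitValue_le_exp_mul hβ hθk (π.act_mem k _)) (Real.exp_pos _).le

theorem limitValue_le_cost (hβ : 0 ≤ β) (hθ : θ < 0) (π : Policy) (x : ℤ) :
    limitValue q β θ x ≤ cost q β π x θ := by
  refine ge_of_tendsto' (tendsto_integral_exp_accrued hβ hθ q π x) fun k => ?_
  rw [← stageValue_zero q β θ π x]
  refine (monotone_nat_of_le_succ (stageValue_le_succ hβ hθ.le π x) (Nat.zero_le k)).trans ?_
  refine integral_mono (integrable_stage hβ hθ.le π x k) (integrable_of_mem_Icc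
    (measurable_comp_history π x k fun h => Real.exp (θ * accrued β h))
    fun z => exp_accrued_mem_Icc hβ hθ.le _) fun z => ?_
  exact mul_le_of_le_one_right (Real.exp_pos _).le
    (limitValue_mem_Icc hβ (mul_pow_nonpos hβ hθ.le k) _).2

/-- The decision rule `g` attains the minimum in the Bellman equation at the risk parameter `θ`. -/
def IsMinimising (q : PMF ℤ) (β θ : ℝ) (g : DecisionRule) : Prop :=
  ∀ x, Real.exp (θ * g.1 x) * expNext q (limitValue q β (θ * β)) x (g.1 x) = limitValue q β θ x

theorem exists_isMinimising (hβ : 0 ≤ β) (hθ : θ ≤ 0) : ∃ g, IsMinimising q β θ g := by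
  have h : ∀ x, ∃ a ∈ actions x,
      Real.exp (θ * a) * expNext q (limitValue q β (θ * β)) x a = limitValue q β θ x := by
    intro x
    obtain ⟨a, ha, h⟩ := Finset.exists_mem_eq_inf' (actions_nonempty x)
      fun a : ℕ => Real.exp (θ * a) * expNext q (limitValue q β (θ * β)) x a
    exact ⟨a, ha, h.symm.trans (bellman_limitValue hβ hθ x)⟩
  choose g hg h using h
  exact ⟨⟨g, hg⟩, h⟩

theorem stageValue_of_isMinimising (hβ : 0 ≤ β) (hθ : θ ≤ 0) {g : ℕ → DecisionRule}
    (hg : ∀ k, IsMinimising q β (θ * β ^ k) (g k)) (x : ℤ) (k : ℕ) :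
    stageValue q β θ (Policy.ofMarkov g) x k = limitValue q β θ x := by
  induction k with
  | zero => exact stageValue_zero ..
  | succ k ih =>
    rw [stageValue_succ hβ hθ, ← ih]
    refine integral_congr_ae (Filter.Eventually.of_forall fun z => ?_)
    exact congrArg _ (hg k (history (Policy.ofMarkov g) x z k).2)

theorem posPart_history_le (π : Policy) (x : ℤ) (z : ℕ → ℤ) (k : ℕ) :
    posPart (history π x z k).2 ≤ posPart x + ∑ i ∈ Finset.range k, posPart (z i) := by
  induction k with
  | zero => simp [history]
  | succ k ih =>
    have h := posPart_nextState_le (π.act_mem k (history π x z k)) (z k)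
    have h0 : (0 : ℝ) ≤ π.act k (history π x z k) := Nat.cast_nonneg _
    rw [Finset.sum_range_succ]
    change posPart (nextState _ _ _) ≤ _
    linarith

theorem integrable_posPart_income (hq : Integrable posPart q.toMeasure) (i : ℕ) :
    Integrable (fun z : ℕ → ℤ => posPart (z i)) (incomeLaw q) :=
  (measurePreserving_eval_infinitePi (fun _ : ℕ => q.toMeasure) i).integrable_comp_of_integrable hq

theorem integral_posPart_income (q : PMF ℤ) (i : ℕ) :
    ∫ z, posPart (z i) ∂incomeLaw q = meanPos q := by
  have h : (incomeLaw q).map (fun z => z i) = q.toMeasure := Measure.infinitePi_map_eval _ i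
  rw [meanPos, ← h, integral_map (measurable_pi_apply i).aemeasurable
    Measurable.of_discrete.aestronglyMeasurable]

/-- Along any policy the surplus grows at most linearly in the mean, so discounting makes the
continuation value at stage `k` tend to `1`. -/
theorem integral_exp_accrued_sub_stageValue_le (hβ0 : 0 ≤ β) (hβ1 : β < 1) (hθ : θ ≤ 0)
    (hq : Integrable posPart q.toMeasure) (π : Policy) (x : ℤ) (k : ℕ) :
    ∫ z, Real.exp (θ * accrued β (history π x z k)) ∂incomeLaw q - stageValue q β θ π x k ≤
      -θ * (β ^ k * (posPart x + gainBound q β) + meanPos q * (k * β ^ k)) := by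
  have hi1 : Integrable (fun z => Real.exp (θ * accrued β (history π x z k))) (incomeLaw q) :=
    integrable_of_mem_Icc (measurable_comp_history π x k fun h => Real.exp (θ * accrued β h))
      fun z => exp_accrued_mem_Icc hβ0 hθ _
  have hi2 : Integrable (fun z : ℕ → ℤ => ∑ i ∈ Finset.range k, posPart (z i)) (incomeLaw q) :=
    integrable_finsetSum _ fun i _ => integrable_posPart_income hq i
  have hi3 := ((integrable_const (μ := incomeLaw q) (posPart x)).add hi2).add
    (integrable_const (gainBound q β))
  have hθk := mul_pow_nonpos hβ0 hθ k
  unfold stageValue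
  rw [← integral_sub hi1 (integrable_stage hβ0 hθ π x k)]
  calc _ ≤ ∫ z : ℕ → ℤ, -(θ * β ^ k) *
        (posPart x + ∑ i ∈ Finset.range k, posPart (z i) + gainBound q β) ∂incomeLaw q := by
        refine integral_mono (hi1.sub (integrable_stage hβ0 hθ π x k)) (hi3.const_mul _) fun z => ?_
        have h1 := exp_accrued_mem_Icc hβ0 hθ (history π x z k)
        have h2 := exp_le_limitValue hβ0 hβ1 hq hθk (history π x z k).2
        have h3 := (limitValue_mem_Icc (q := q) hβ0 hθk (history π x z k).2).2
        have h4 := Real.add_one_le_exp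
          (θ * β ^ k * (posPart (history π x z k).2 + gainBound q β))
        have h5 := mul_le_mul_of_nonpos_left
          (add_le_add_left (posPart_history_le π x z k) (gainBound q β)) hθk
        dsimp only
        have h6 := mul_le_of_le_one_left (sub_nonneg.2 h3) h1.2
        linarith
    _ = _ := by
        have hs : ∫ z : ℕ → ℤ, (posPart x + ∑ i ∈ Finset.range k, posPart (z i) + gainBound q β)
            ∂incomeLaw q = posPart x + k * meanPos q + gainBound q β := by
          rw [integral_add (f := fun z : ℕ → ℤ => posPart x + ∑ i ∈ Finset.range k, posPart (z i))
              ((integrable_const _).add hi2) (integrable_const _),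
            integral_add (integrable_const _) hi2,
            integral_finsetSum _ fun i _ => integrable_posPart_income hq i]
          simp [integral_posPart_income]
        rw [integral_const_mul, hs]
        ring

/-- A Markov policy whose decision rules attain the minima in the Bellman equation attains the
limit of value iteration. -/
theorem cost_of_isMinimising (hβ0 : 0 ≤ β) (hβ1 : β < 1) (hθ : θ < 0)
    (hq : Integrable posPart q.toMeasure) {g : ℕ → DecisionRule}
    (hg : ∀ k, IsMinimising q β (θ * β ^ k) (g k)) (x : ℤ) :
    cost q β (Policy.ofMarkov g) x θ = limitValue q β θ x := by
  refine le_antisymm ?_ (limitValue_le_cost hβ0 hθ _ x)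
  have h1 := (tendsto_integral_exp_accrued hβ0 hθ q (Policy.ofMarkov g) x).sub_const
    (limitValue q β θ x)
  have h2 : Filter.Tendsto (fun k : ℕ =>
      -θ * (β ^ k * (posPart x + gainBound q β) + meanPos q * (k * β ^ k)))
      Filter.atTop (nhds (-θ * (0 * (posPart x + gainBound q β) + meanPos q * 0))) :=
    (((tendsto_pow_atTop_nhds_zero_of_lt_one hβ0 hβ1).mul_const _).add
      ((tendsto_self_mul_const_pow_of_lt_one hβ0 hβ1).const_mul _)).const_mul _
  have h3 := le_of_tendsto_of_tendsto' h1 h2 fun k => by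
    rw [← stageValue_of_isMinimising hβ0 hθ.le hg x k]
    exact integral_exp_accrued_sub_stageValue_le hβ0 hβ1 hθ.le hq _ x k
  simp only [zero_mul, mul_zero, add_zero] at h3
  linarith

theorem value_eq_limitValue (hβ0 : 0 ≤ β) (hβ1 : β < 1) (hθ : θ < 0)
    (hq : Integrable posPart q.toMeasure) (x : ℤ) : value q β x θ = limitValue q β θ x := by
  have hne : Nonempty Policy := ⟨Policy.ofMarkov fun _ => ⟨fun _ => 0, zero_mem_actions⟩⟩
  refine le_antisymm ?_ (le_ciInf fun π => limitValue_le_cost hβ0 hθ π x)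
  choose g hg using fun k => exists_isMinimising (q := q) hβ0 (mul_pow_nonpos hβ0 hθ.le k)
  rw [← cost_of_isMinimising hβ0 hβ1 hθ hq hg x]
  exact ciInf_le ⟨limitValue q β θ x, by
    rintro _ ⟨π, rfl⟩; exact limitValue_le_cost hβ0 hθ π x⟩ _

/-! ### The decision rules `f^*` -/

theorem G_eq_integral (hβ0 : 0 ≤ β) (hβ1 : β < 1) (hθ : θ < 0)
    (hq : Integrable posPart q.toMeasure) (x : ℤ) :
    G q β x θ = ∫ z, limitValue q β θ (x + z) ∂q.toMeasure := by
  rw [PMF.integral_eq_tsum _ _ (integrable_of_mem_Icc .of_discrete fun z =>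
    limitValue_mem_Icc hβ0 hθ.le _)]
  refine tsum_congr fun k => ?_
  rw [smul_eq_mul, mul_comm]
  split_ifs with h
  · rw [value_eq_limitValue hβ0 hβ1 hθ hq]
  · rw [limitValue_of_neg (by omega)]

theorem G_eq_expNext (hβ0 : 0 ≤ β) (hβ1 : β < 1) (hθ : θ < 0)
    (hq : Integrable posPart q.toMeasure) {x : ℤ} (hx : 0 ≤ x) (a : ℕ) :
    G q β (x - a) θ = expNext q (limitValue q β θ) x a := by
  simp [G_eq_integral hβ0 hβ1 hθ hq, expNext, nextState, hx]

theorem fStar_of_neg {x : ℤ} (hx : x < 0) : fStar q β x θ = 0 := by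
  simp [fStar, hx.not_ge]

theorem fStar_mem_minimisers {x : ℤ} (hx : 0 ≤ x) : fStar q β x θ ∈ minimisers q β x θ := by
  rw [fStar, if_pos hx]
  exact Finset.max'_mem _ _

theorem fStar_isMinimising (hβ0 : 0 < β) (hβ1 : β < 1) (hθ : θ < 0)
    (hq : Integrable posPart q.toMeasure) :
    IsMinimising q β θ ⟨fun x => fStar q β x θ, fun x => fStar_mem q β x θ⟩ := by
  intro x
  have hθ' : θ * β < 0 := mul_neg_of_neg_of_pos hθ hβ0
  rcases lt_or_ge x 0 with hx | hx
  · simp [fStar_of_neg hx, expNext, nextState, hx.not_ge, limitValue_of_neg hx]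
  · refine le_antisymm ?_ (limitValue_le_exp_mul hβ0.le hθ.le (fStar_mem q β x θ))
    rw [← bellman_limitValue hβ0.le hθ.le]
    refine le_bellman fun b hb => ?_
    have h := (Finset.mem_filter.1 (fStar_mem_minimisers (q := q) (β := β) (θ := θ) hx)).2 b hb
    simpa only [G_eq_expNext hβ0.le hβ1 hθ' hq hx] using h

/-- The surplus `x - f^*(x, θ)` that is left after the dividend. -/
def restLevel (q : PMF ℤ) (β θ : ℝ) (x : ℕ) : ℕ := x - fStar q β x θ

/-- The cost of paying down to the level `y`, up to the factor `exp (θ x)`, in which `x` is the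
surplus before the payment. -/
def levelCost (q : PMF ℤ) (β θ : ℝ) (y : ℕ) : ℝ := Real.exp (-θ * y) * G q β y (θ * β)

theorem fStar_natCast_le (q : PMF ℤ) (β θ : ℝ) (x : ℕ) : fStar q β x θ ≤ x := by
  have := fStar_mem q β x θ
  simp only [actions, Finset.mem_range, Int.toNat_natCast] at this
  omega

theorem exp_mul_G_eq (q : PMF ℤ) (β θ : ℝ) {x b : ℕ} (hb : b ≤ x) :
    Real.exp (θ * b) * G q β ((x : ℤ) - b) (θ * β) =
      Real.exp (θ * x) * levelCost q β θ (x - b) := by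
  rw [levelCost, ← mul_assoc, ← Real.exp_add, Nat.cast_sub hb, Nat.cast_sub hb]
  congr 2
  ring

theorem mem_minimisers_iff {x b : ℕ} : b ∈ minimisers q β x θ ↔
    b ≤ x ∧ ∀ s ≤ x, levelCost q β θ (x - b) ≤ levelCost q β θ s := by
  simp only [minimisers, Finset.mem_filter, actions, Int.toNat_natCast, Finset.mem_range,
    Nat.lt_succ_iff]
  refine and_congr_right fun hb => ⟨fun h s hs => ?_, fun h c hc => ?_⟩
  · have := h (x - s) (Nat.sub_le x s)
    rw [exp_mul_G_eq q β θ hb, exp_mul_G_eq q β θ (Nat.sub_le x s), Nat.sub_sub_self hs] at this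
    exact le_of_mul_le_mul_left this (Real.exp_pos _)
  · rw [exp_mul_G_eq q β θ hb, exp_mul_G_eq q β θ hc]
    exact mul_le_mul_of_nonneg_left (h _ (Nat.sub_le x c)) (Real.exp_pos _).le

theorem restLevel_le (q : PMF ℤ) (β θ : ℝ) (x : ℕ) : restLevel q β θ x ≤ x := Nat.sub_le _ _

theorem levelCost_restLevel_le {x s : ℕ} (hs : s ≤ x) :
    levelCost q β θ (restLevel q β θ x) ≤ levelCost q β θ s :=
  (mem_minimisers_iff.1 (fStar_mem_minimisers (Int.natCast_nonneg x))).2 s hs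

/-- The largest minimising dividend leads to the smallest minimising level, which is thus a strict
record of `levelCost`. -/
theorem levelCost_restLevel_lt {x s : ℕ} (hs : s < restLevel q β θ x) :
    levelCost q β θ (restLevel q β θ x) < levelCost q β θ s := by
  by_contra! h
  have hx := restLevel_le q β θ x
  have hmem : x - s ∈ minimisers q β x θ := by
    refine mem_minimisers_iff.2 ⟨Nat.sub_le x s, fun r hr => ?_⟩
    rw [Nat.sub_sub_self (by omega)]
    exact h.trans (levelCost_restLevel_le hr)
  have hmax : x - s ≤ fStar q β x θ := by
    rw [fStar, if_pos (Int.natCast_nonneg x)]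
    exact Finset.le_max' _ _ hmem
  have := fStar_natCast_le q β θ x
  unfold restLevel at hs hx
  omega

theorem restLevel_succ (q : PMF ℤ) (β θ : ℝ) (x : ℕ) :
    restLevel q β θ (x + 1) = x + 1 ∨ restLevel q β θ (x + 1) = restLevel q β θ x := by
  refine or_iff_not_imp_left.2 fun h => ?_
  have h1 := restLevel_le q β θ (x + 1)
  have h2 := restLevel_le q β θ x
  rcases lt_trichotomy (restLevel q β θ (x + 1)) (restLevel q β θ x) with h3 | h3 | h3
  · exact absurd (levelCost_restLevel_lt h3) (levelCost_restLevel_le (by omega)).not_gt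
  · exact h3
  · exact absurd (levelCost_restLevel_lt h3) (levelCost_restLevel_le (by omega)).not_gt

theorem mem_zeroLevels_iff {x : ℕ} : x ∈ zeroLevels q β θ ↔ restLevel q β θ x = x := by
  have := fStar_natCast_le q β θ x
  simp only [zeroLevels, Set.mem_ofPred_eq, restLevel]
  omega

/-- Holding on to the surplus `x` costs the discount factor on `x` and gains at most
`gainBound q β`, so nothing is paid only if `(1 - β) x ≤ gainBound q β`. -/
theorem le_of_mem_zeroLevels (hβ0 : 0 < β) (hβ1 : β < 1) (hθ : θ < 0)
    (hq : Integrable posPart q.toMeasure) {x : ℕ} (hx : x ∈ zeroLevels q β θ) :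
    (x : ℝ) ≤ gainBound q β / (1 - β) := by
  have hβ : 0 < 1 - β := by linarith
  have hθ' : θ * β < 0 := mul_neg_of_neg_of_pos hθ hβ0
  have hG : ∀ y : ℕ, G q β y (θ * β) = expNext q (limitValue q β (θ * β)) y 0 := fun y => by
    simpa using G_eq_expNext hβ0.le hβ1 hθ' hq (Int.natCast_nonneg y) 0
  have h0 : levelCost q β θ 0 ≤ 1 := by
    rw [levelCost, hG]
    simpa using (expNext_mem_Icc q (fun y => limitValue_mem_Icc hβ0.le hθ'.le y) 0 0).2
  have h1 : levelCost q β θ x ≤ levelCost q β θ 0 := by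
    have := levelCost_restLevel_le (q := q) (β := β) (θ := θ) (Nat.zero_le x)
    rwa [mem_zeroLevels_iff.1 hx] at this
  have h2 := exp_le_expNext hq hθ'.le (fun y => limitValue_mem_Icc hβ0.le hθ'.le y)
    (gainBound_nonneg hβ0.le hβ1) (fun y => exp_le_limitValue hβ0.le hβ1 hq hθ'.le y)
    (zero_mem_actions (x : ℤ))
  have hpos : posPart (x : ℤ) = x := by simp [posPart]
  have h3 : Real.exp (-θ * x + θ * β * (x - (0 : ℕ) + meanPos q + gainBound q β)) ≤ 1 := by
    rw [Real.exp_add, ← hpos]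
    refine le_trans ?_ (h1.trans h0)
    rw [levelCost, hG, ← hpos]
    exact mul_le_mul_of_nonneg_left h2 (Real.exp_pos _).le
  rw [Real.exp_le_one_iff] at h3
  have hg := gainBound_eq (q := q) hβ1
  have h4 : θ * (gainBound q β - (1 - β) * x) ≤ 0 := by
    calc _ = θ * (β * (meanPos q + gainBound q β) - (1 - β) * x) := by rw [hg]
      _ ≤ 0 := by push_cast at h3; linarith
  rw [le_div_iff₀ hβ]
  have := nonneg_of_mul_nonpos_right h4 hθ
  linarith

theorem bddAbove_zeroLevels (hβ0 : 0 < β) (hβ1 : β < 1) (hθ : θ < 0)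
    (hq : Integrable posPart q.toMeasure) : BddAbove (zeroLevels q β θ) :=
  ⟨⌊gainBound q β / (1 - β)⌋₊, fun _ hx => Nat.le_floor (le_of_mem_zeroLevels hβ0 hβ1 hθ hq hx)⟩

theorem restLevel_zero (q : PMF ℤ) (β θ : ℝ) : restLevel q β θ 0 = 0 :=
  Nat.le_zero.1 (restLevel_le q β θ 0)

theorem restLevel_of_xi_le (h : BddAbove (zeroLevels q β θ)) {x : ℕ} (hx : xi q β θ ≤ x) :
    restLevel q β θ x = xi q β θ := by
  induction x, hx using Nat.le_induction with
  | base =>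
    exact mem_zeroLevels_iff.1 (Nat.sSup_mem ⟨0, mem_zeroLevels_iff.2 (restLevel_zero q β θ)⟩ h)
  | succ x hx ih =>
    rcases restLevel_succ q β θ x with h1 | h1
    · have : x + 1 ≤ xi q β θ := le_csSup h (mem_zeroLevels_iff.2 h1)
      omega
    · rw [h1, ih]

theorem fStar_natCast (q : PMF ℤ) (β θ : ℝ) (x : ℕ) :
    (fStar q β x θ : ℤ) = x - restLevel q β θ x := by
  have := fStar_natCast_le q β θ x
  unfold restLevel
  omega

theorem isBandFunction_fStar (h : BddAbove (zeroLevels q β θ)) :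
    IsBandFunction ⟨fun x => fStar q β x θ, fun x => fStar_mem q β x θ⟩ := by
  obtain ⟨n, c, d, hcd, hc, hcN, hx⟩ :=
    exists_bands (restLevel_zero q β θ) (restLevel_succ q β θ) (xi q β θ)
  rw [restLevel_of_xi_le h le_rfl] at hc
  refine ⟨n, c, d, hcd, fun x => ?_⟩
  dsimp only
  rcases lt_or_ge x 0 with hx0 | hx0
  · exact ⟨fun _ => fStar_of_neg hx0, fun k _ h1 => by omega, fun k _ h1 => by omega,
      fun h1 => by omega⟩
  · lift x to ℕ using hx0
    have hf := fStar_natCast q β θ x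
    rcases le_or_gt x (xi q β θ) with hxi | hxi
    · obtain ⟨h1, h2, h3, h4⟩ := hx x hxi
      refine ⟨fun h => ?_, fun k hk hl hr => ?_, fun k hk hl hr => ?_, fun h => ?_⟩
      · have := h1 (by omega); omega
      · have := h2 k hk (by omega) (by omega); omega
      · have := h3 k hk (by omega) (by omega); omega
      · have := h4 (by omega); omega
    · have hr := restLevel_of_xi_le h hxi.le
      refine ⟨fun h => ?_, fun k hk _ h2 => ?_, fun k hk _ h2 => ?_, fun _ => by omega⟩
      · have := hcN 0 (Nat.zero_le n); omega
      · have := hcd k hk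
        have := hcN (k + 1) hk
        omega
      · have := hcN (k + 1) hk
        omega

/-! ### Optimality -/

theorem expectedUtility_eq (q : PMF ℤ) (β γ : ℝ) (π : Policy) (x : ℤ) :
    expectedUtility q β γ π x = 1 / γ * cost q β π x γ :=
  integral_const_mul _ _

theorem isOptimal_piStar {γ : ℝ} (hβ0 : 0 < β) (hβ1 : β < 1) (hγ : γ < 0)
    (hq : Integrable posPart q.toMeasure) : IsOptimal q β γ (Policy.ofMarkov (piStar q β γ)) := by
  intro x
  have hcost : cost q β (Policy.ofMarkov (piStar q β γ)) x γ = limitValue q β γ x :=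
    cost_of_isMinimising hβ0.le hβ1 hγ hq (fun k =>
      fStar_isMinimising hβ0 hβ1 (mul_neg_of_neg_of_pos hγ (pow_pos hβ0 k)) hq) x
  refine IsGreatest.isLUB ⟨⟨_, rfl⟩, ?_⟩
  rintro _ ⟨π, rfl⟩
  simp only [expectedUtility_eq, hcost]
  -- minimal cost is maximal utility, because `1 / γ < 0`
  exact mul_le_mul_of_nonpos_left (limitValue_le_cost hβ0.le hγ π x)
    (one_div_nonpos.2 hγ.le)

end Dividend

end

theorem mainTheorem2 (q : PMF ℤ) (β γ : ℝ) (hβ0 : 0 < β) (hβ1 : β < 1) (hγ : γ < 0)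
    (hA1 : MeasureTheory.Integrable (fun k : ℤ => ((max k 0 : ℤ) : ℝ)) q.toMeasure)
    (hA2 : 0 < q.toMeasure (Set.Iio (0 : ℤ))) :
    Dividend.IsOptimal q β γ (Dividend.Policy.ofMarkov (Dividend.piStar q β γ)) ∧
    Dividend.IsBandPolicy (Dividend.piStar q β γ) ∧
    ∀ n : ℕ,
      BddAbove (Dividend.zeroLevels q β (γ * β ^ n)) ∧
      ∀ x : ℤ, (Dividend.xi q β (γ * β ^ n) : ℤ) < x →
        (((Dividend.piStar q β γ n).1 x : ℕ) : ℤ) = x - Dividend.xi q β (γ * β ^ n) := by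
  have hbdd : ∀ n : ℕ, BddAbove (Dividend.zeroLevels q β (γ * β ^ n)) := fun n =>
    Dividend.bddAbove_zeroLevels hβ0 hβ1 (mul_neg_of_neg_of_pos hγ (pow_pos hβ0 n)) hA1
  refine ⟨Dividend.isOptimal_piStar hβ0 hβ1 hγ hA1,
    fun n => Dividend.isBandFunction_fStar (hbdd n), fun n => ⟨hbdd n, fun x hx => ?_⟩⟩
  lift x to ℕ using by omega
  rw [← Dividend.restLevel_of_xi_le (hbdd n) (x := x) (by omega)]
  exact Dividend.fStar_natCast q β (γ * β ^ n) x
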